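/- Let $G$ be a finite simple undirected graph. A star edge coloring of $G$ is a proper edge coloring of $G$ in which no path with four edges and no cycle with four edges is bi-colored (uses only two colors). The star chromatic index $\chi'_s(G)$ is the minimum $k$ such that $G$ admits a star edge coloring with $k$ colors. A Cactus is a graph in which every edge belongs to at most one cycle. Theorem. If $G$ is a Cactus with maximum degree $\Delta$, then \[\chi'_s(G)\le\left\lfloor\frac{3\Delta}{2}\right\rfloor+1.\] -/

import Mathlib

namespace SimpleGraph

variable {V : Type*} (G : SimpleGraph V)

/-- A cactus: every edge belongs to at most one cycle. Cycles are compared as subgraphs, so that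
the choice of a starting vertex and of a direction does not matter. -/
def IsCactus : Prop :=
  ∀ ⦃u v : V⦄ (p : G.Walk u u) (q : G.Walk v v), p.IsCycle → q.IsCycle →
    ∀ e : Sym2 V, e ∈ p.edges → e ∈ q.edges → p.toSubgraph = q.toSubgraph

variable {G}

/-- The edges of the walk `p` receive at most two colors (exactly two, if the coloring is proper
and `p` is a path or a cycle with at least two edges). -/
def IsBicolored {K : Type*} (c : G.edgeSet → K) {u v : V} (p : G.Walk u v) : Prop :=
  ∃ a b : K, ∀ e : G.edgeSet, (e : Sym2 V) ∈ p.edges → c e = a ∨ c e = b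

/-- A proper edge coloring (a proper vertex coloring of the line graph) is a star edge coloring if
no path with four edges and no cycle with four edges is bi-colored. -/
def IsStarEdgeColoring {K : Type*} (c : G.lineGraph.Coloring K) : Prop :=
  (∀ ⦃u v : V⦄ (p : G.Walk u v), p.IsPath → p.length = 4 → ¬ IsBicolored c p) ∧
  (∀ ⦃u : V⦄ (p : G.Walk u u), p.IsCycle → p.length = 4 → ¬ IsBicolored c p)

variable (G)

/-- `G` has a star edge coloring with `k` colors. -/
def StarEdgeColorable (k : ℕ) : Prop :=
  ∃ c : G.lineGraph.Coloring (Fin k), IsStarEdgeColoring c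

/-- The star chromatic index: the least number of colors in a star edge coloring of `G` (and `⊤` if
no finite number of colors suffices, which cannot happen for a finite graph). -/
noncomputable def starChromaticIndex : ℕ∞ :=
  ⨅ k : {k : ℕ // G.StarEdgeColorable k}, ((k : ℕ) : ℕ∞)

end SimpleGraph

/-! ### Cycles in a cactus and the existence of a pendant cycle. -/

namespace SimpleGraph

variable {V : Type*} {G : SimpleGraph V}

/-! Put D = Δ. Each vertex v gets a palette `C v` of D colors and an asymmetric relation `T v`, such
that the color of an edge vw dominates, at both ends, all other colors common to the two palettes
(`Scheme`). This excludes bicolored walks x₀x₁x₂x₃x₄ with color pattern a, b, a, b: a lies in the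
palette of x₁, so b dominates a at x₂; b lies in the palette of x₃, so a dominates b at x₂.

Schemes are built by induction on the edge set. A graph with an edge, no leaf and edge-disjoint
cycles has a cycle with all vertices but one, x, of degree two (`exists_pendant_cycle`), so one
always adds back a leaf or such a cycle.

For a leaf on an edge of color b at u, the new palette consists of b, some colors dominated by b at
u, and colors outside `C u`, of which there are D/2 + 1. Nearly regular tournaments make every
available color dominate enough colors, and about half of the available ones ("high" colors)
dominate enough to let the new palette avoid one further color.

For a cycle, the edges at x get available colors α and β, α high. Along the path starting with α,
each new palette has a "king" dominating the rest, which colors the next edge. A color f outside `C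
x` is kept out of these palettes until the last two vertices, where it is king at both ends of their
common edge. The closing edge gets β. -/

/-- Any two cycles with a common edge have the same edges. -/
def CyclesEdgeDisjoint (G : SimpleGraph V) : Prop :=
  ∀ ⦃u v : V⦄ (p : G.Walk u u) (q : G.Walk v v), p.IsCycle → q.IsCycle →
    ∀ e ∈ p.edges, e ∈ q.edges → ∀ e' ∈ p.edges, e' ∈ q.edges

theorem IsCactus.cyclesEdgeDisjoint (hG : G.IsCactus) : G.CyclesEdgeDisjoint := by
  intro u v p q hp hq e hep heq e' he'
  rw [← Walk.mem_edges_toSubgraph] at he' ⊢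
  rwa [← hG p q hp hq e hep heq]

theorem CyclesEdgeDisjoint.mono {H : SimpleGraph V} (hG : G.CyclesEdgeDisjoint) (h : H ≤ G) :
    H.CyclesEdgeDisjoint := by
  intro u v p q hp hq e hep heq e' he'
  have := hG (p.mapLe h) (q.mapLe h) ((Walk.isCycle_mapLe h).2 hp) ((Walk.isCycle_mapLe h).2 hq) e
    (by simpa using hep) (by simpa using heq) e' (by simpa using he')
  simpa using this

/-- Each path together with its chord is a cycle; a shared path edge makes the two cycles coincide.
-/
theorem CyclesEdgeDisjoint.mem_of_chord (hG : G.CyclesEdgeDisjoint) {x b y t : V}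
    {d : G.Walk x b} (hd : d.IsPath) (hbx : G.Adj b x) (hd' : s(b, x) ∉ d.edges)
    {r : G.Walk y t} (hr : r.IsPath) (hty : G.Adj t y) (hr' : s(t, y) ∉ r.edges)
    {e : Sym2 V} (hed : e ∈ d.edges) (her : e ∈ r.edges) {e' : Sym2 V}
    (he' : e' ∈ r.edges ∨ e' = s(t, y)) : e' ∈ d.edges ∨ e' = s(b, x) := by
  have := hG (.cons hty r) (.cons hbx d) ((Walk.cons_isCycle_iff r hty).2 ⟨hr, hr'⟩)
    ((Walk.cons_isCycle_iff d hbx).2 ⟨hd, hd'⟩) e (by simp [her]) (by simp [hed]) e'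
    (by simpa using he'.symm)
  simpa [or_comm] using this

/-- A path extends to a path that cannot be prolonged. -/
theorem Walk.IsPath.exists_maximal_append [Finite V] {a v : V} {p : G.Walk a v} (hp : p.IsPath) :
    ∃ (t : V) (e : G.Walk v t), (p.append e).IsPath ∧
      ∀ y, G.Adj t y → y ∈ (p.append e).support := by
  classical
  have := Fintype.ofFinite V
  by_contra! hcon
  have key : ∀ n, ∃ (t : V) (e : G.Walk v t), (p.append e).IsPath ∧ n ≤ (p.append e).length := by
    intro n
    induction n with
    | zero => exact ⟨v, .nil, by simpa using hp, Nat.zero_le _⟩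
    | succ n ih =>
      obtain ⟨t, e, he, hn⟩ := ih
      obtain ⟨y, hy, hy'⟩ := hcon t e he
      refine ⟨y, e.concat hy, ?_, ?_⟩
      · rw [Walk.append_concat]
        exact he.concat hy' hy
      · simp only [Walk.length_append, Walk.length_concat] at hn ⊢
        omega
  obtain ⟨t, e, he, hn⟩ := key (Fintype.card V)
  exact absurd he.length_lt (by omega)

/-- In a graph without vertices of degree one, a path extends to one whose last vertex is joined
by a further edge to an earlier vertex. -/
theorem Walk.IsPath.exists_append_chord [Finite V]
    (hdeg : ∀ v w, G.Adj v w → ∃ w', w' ≠ w ∧ G.Adj v w')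
    {a v u : V} {p : G.Walk a v} (hp : p.IsPath) (hvu : G.Adj v u) :
    ∃ (t : V) (e : G.Walk v t) (y : V), (p.append e).IsPath ∧ G.Adj t y ∧
      y ∈ (p.append e).support ∧ s(t, y) ∉ (p.append e).edges := by
  obtain ⟨t, e, he, hmax⟩ := hp.exists_maximal_append
  have hnil : ¬ (p.append e).Nil := by
    intro h
    rw [Walk.nil_append_iff] at h
    obtain ⟨hp0, he0⟩ := h
    cases hp0
    cases he0
    have := hmax u hvu
    simp only [Walk.append_nil, Walk.support_nil, List.mem_singleton] at this
    exact hvu.ne this.symm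
  obtain ⟨y, hy, hty⟩ := hdeg t _ (Walk.adj_penultimate hnil).symm
  refine ⟨t, e, y, he, hty, hmax y hty, fun h => hy ?_⟩
  exact he.eq_penultimate_of_mem_edges h

/-- A finite graph with an edge and without vertices of degree one, whose cycles are edge-disjoint,
has a cycle all of whose vertices but one have degree two. -/
theorem CyclesEdgeDisjoint.exists_pendant_cycle [Finite V] (hG : G.CyclesEdgeDisjoint)
    (hne : ∃ v w, G.Adj v w) (hdeg : ∀ v w, G.Adj v w → ∃ w', w' ≠ w ∧ G.Adj v w') :
    ∃ (x b : V) (d : G.Walk x b), G.Adj b x ∧ d.IsPath ∧ s(b, x) ∉ d.edges ∧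
      ∀ z ∈ d.support, z ≠ x → ∀ y, G.Adj z y → s(z, y) ∈ d.edges ∨ s(z, y) = s(b, x) := by
  classical
  have := Fintype.ofFinite V
  -- A lollipop: a tail `q` followed by the cycle formed by `d` and bx. One with the longest tail is
  -- pendant.
  let P : ℕ → Prop := fun n => ∃ (a x b : V) (q : G.Walk a x) (d : G.Walk x b),
    (q.append d).IsPath ∧ G.Adj b x ∧ s(b, x) ∉ d.edges ∧ q.length = n
  have hP0 : ∃ n, P n := by
    obtain ⟨v, w, hvw⟩ := hne
    obtain ⟨t, e, y, he, hty, hy, hty'⟩ :=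
      Walk.IsPath.exists_append_chord hdeg (Walk.IsPath.nil (G := G) (u := v)) hvw
    rw [Walk.nil_append] at he hy hty'
    exact ⟨_, v, y, t, e.takeUntil y hy, e.dropUntil y hy, by rwa [Walk.take_spec], hty,
      fun h => hty' (e.edges_dropUntil_subset_edges hy h), rfl⟩
  obtain ⟨n, hn, hmax⟩ : ∃ n, P n ∧ ∀ m, P m → m ≤ n := by
    have hb : ∀ m, P m → m ≤ Fintype.card V := by
      rintro m ⟨a, x, b, q, d, h, -, -, rfl⟩
      have := h.length_lt
      rw [Walk.length_append] at this
      omega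
    obtain ⟨n, hn⟩ := hP0
    exact ⟨_, Nat.findGreatest_spec (hb n hn) hn, fun m hm => Nat.le_findGreatest (hb m hm) hm⟩
  obtain ⟨a, x, b, q, d, hqd, hbx, hbx', hq⟩ := hn
  have hd := hqd.of_append_right
  refine ⟨x, b, d, hbx, hd, hbx', fun z hz hzx y hzy => ?_⟩
  by_contra! hcon
  obtain ⟨hcon1, hcon2⟩ := hcon
  have hcon3 : ¬ (s(z, y) ∈ d.edges ∨ s(z, y) = s(b, x)) := by tauto
  obtain ⟨d₁, d₂, rfl⟩ : ∃ (d₁ : G.Walk x z) (d₂ : G.Walk z b), d = d₁.append d₂ :=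
    ⟨_, _, (d.take_spec hz).symm⟩
  have hzq : z ∉ q.support := fun h =>
    hqd.ne_of_mem_support_of_append hzx h hz rfl
  have hqd' : ((q.append d₁).append d₂).IsPath := by rwa [← Walk.append_assoc]
  have hqd₁ := hqd'.of_append_left
  have hzyq : s(z, y) ∉ q.edges := fun h => hzq (q.fst_mem_support_of_mem_edges h)
  rw [Walk.edges_append, List.mem_append, not_or] at hcon1
  have hd₁nil : ¬ d₁.Nil := fun h => hzx h.eq.symm
  -- If y lies on the lollipop, zy closes a cycle that shares with the cycle of `d` a path edge at z
  -- or y, hence zy belongs to the latter.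
  by_cases hy1 : y ∈ (q.append d₁).support
  · have hp := hqd₁.dropUntil hy1
    have hnil : ¬ ((q.append d₁).dropUntil y hy1).Nil := fun h => hzy.ne h.eq.symm
    have he1 := Walk.mk_penultimate_end_mem_edges hnil
    have he2 := (q.append d₁).edges_dropUntil_subset_edges hy1 he1
    rw [Walk.edges_append, List.mem_append] at he2
    refine hcon3 (hG.mem_of_chord hd hbx hbx' hp hzy ?_
      (e := s(((q.append d₁).dropUntil y hy1).penultimate, z)) ?_ he1 (.inr rfl))
    · intro h
      have := (q.append d₁).edges_dropUntil_subset_edges hy1 h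
      rw [Walk.edges_append, List.mem_append] at this
      tauto
    · rw [Walk.edges_append, List.mem_append]
      exact .inl (he2.resolve_left fun h => hzq (q.snd_mem_support_of_mem_edges h))
  by_cases hy2 : y ∈ d₂.support
  · have hp := hqd'.of_append_right.takeUntil hy2
    have hnil : ¬ (d₂.takeUntil y hy2).Nil := fun h => hzy.ne h.eq
    have he1 := Walk.mk_penultimate_end_mem_edges hnil
    refine hcon3 (hG.mem_of_chord hd hbx hbx' hp hzy.symm ?_ ?_ he1 (.inr Sym2.eq_swap))
    · intro h
      rw [Sym2.eq_swap] at h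
      exact hcon1.2 (d₂.edges_takeUntil_subset_edges hy2 h)
    · rw [Walk.edges_append, List.mem_append]
      exact .inr (d₂.edges_takeUntil_subset_edges hy2 he1)
  -- Otherwise leave the cycle through zy and prolong until a chord ty' appears. If y' is on `q`,
  -- the new cycle contains `d₁` and zy; if not, the tail up to y' is longer than `q`.
  obtain ⟨t, e, y', he, hty, hy', hty'⟩ :=
    Walk.IsPath.exists_append_chord hdeg (hqd₁.concat hy1 hzy) hzy.symm
  obtain ⟨r, hr⟩ : ∃ r : G.Walk x t, r = d₁.append (.cons hzy e) := ⟨_, rfl⟩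
  have hfull : ((q.append d₁).concat hzy).append e = q.append r := by
    rw [hr, Walk.append_assoc, Walk.concat_append]
  rw [hfull] at he hy' hty'
  by_cases hyq : y' ∈ q.support
  · have hp : ((q.dropUntil y' hyq).append r).IsPath := by
      have : (q.takeUntil y' hyq).append ((q.dropUntil y' hyq).append r) = q.append r := by
        rw [Walk.append_assoc, Walk.take_spec]
      rw [← this] at he
      exact he.of_append_right
    have he1 := Walk.mk_penultimate_end_mem_edges hd₁nil
    refine hcon3 (hG.mem_of_chord hd hbx hbx' hp hty ?_ (e := s(d₁.penultimate, z)) ?_ ?_ (.inl ?_))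
    · intro h
      apply hty'
      rw [Walk.edges_append, List.mem_append] at h ⊢
      exact h.imp_left fun h => q.edges_dropUntil_subset_edges hyq h
    · simp [he1]
    · simp [hr, he1]
    · simp [hr]
  · have hyr : y' ∈ r.support := by
      rw [Walk.mem_support_append_iff] at hy'
      tauto
    have hlen := hmax (q.append (r.takeUntil y' hyr)).length
      ⟨a, y', t, q.append (r.takeUntil y' hyr), r.dropUntil y' hyr, by
        rwa [← Walk.append_assoc, Walk.take_spec], hty, fun h => hty' (by
          rw [Walk.edges_append, List.mem_append]
          exact .inr (r.edges_dropUntil_subset_edges hyr h)), rfl⟩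
    rw [Walk.length_append] at hlen
    have h0 : (r.takeUntil y' hyr).length = 0 := by omega
    exact hyq (Walk.eq_of_length_eq_zero h0 ▸ q.end_mem_support)

end SimpleGraph

/-! ### Tournaments on colors and choice of palettes. -/

namespace SimpleGraph

variable {K : Type*}

open Classical in
/-- The elements of `C` that are dominated by `b` in the relation `T`. -/
noncomputable def outSet (T : K → K → Prop) (C : Finset K) (b : K) : Finset K :=
  C.filter (T b)

theorem mem_outSet {T : K → K → Prop} {C : Finset K} {a b : K} :
    a ∈ outSet T C b ↔ a ∈ C ∧ T b a := by
  simp [outSet]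

open Classical in
/-- The elements of `S` that dominate at least `s` elements of `C`. -/
noncomputable def highSet (T : K → K → Prop) (C S : Finset K) (s : ℕ) : Finset K :=
  S.filter fun b => s ≤ (outSet T C b).card

theorem mem_highSet {T : K → K → Prop} {C S : Finset K} {s : ℕ} {b : K} :
    b ∈ highSet T C S s ↔ b ∈ S ∧ s ≤ (outSet T C b).card := by
  simp [highSet]

/-- A nearly regular tournament on the entries of a list. -/
theorem exists_tournament_list [DecidableEq K] {l : List K} (hl : l.Nodup) :
    ∃ T : K → K → Prop, (∀ a b, T a b → ¬ T b a) ∧ (∀ a b, T a b → a ∈ l ∧ b ∈ l) ∧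
      (∀ a ∈ l, ∀ b ∈ l, l.idxOf a < l.idxOf b → l.idxOf b ≤ l.idxOf a + l.length / 2 → T a b) ∧
      (∀ b ∈ l, (l.length - 1) / 2 ≤ (outSet T l.toFinset b).card) ∧
      (l.length + 1) / 2 ≤ (highSet T l.toFinset l.toFinset (l.length / 2)).card := by
  classical
  -- The rotational tournament: each entry beats the next n/2 entries cyclically, except that for
  -- even n an opposite pair is won by the earlier entry. So the first n - n/2 entries are high.
  obtain ⟨T, hT⟩ : ∃ T : K → K → Prop, ∀ a b, T a b ↔ a ∈ l ∧ b ∈ l ∧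
      ((l.idxOf a < l.idxOf b ∧ l.idxOf b ≤ l.idxOf a + l.length / 2) ∨
        l.idxOf b + l.length / 2 < l.idxOf a) := ⟨_, fun a b => Iff.rfl⟩
  have hget : ∀ (x : K) (j : ℕ), j < l.length → l.getD j x ∈ l ∧ l.idxOf (l.getD j x) = j := by
    intro x j hj
    rw [List.getD_eq_getElem _ _ hj]
    exact ⟨List.getElem_mem hj, hl.idxOf_getElem j hj⟩
  have hinj : ∀ (x : K) (I : Finset ℕ), (∀ j ∈ I, j < l.length) →
      Set.InjOn (fun j => l.getD j x) I := by
    intro x I hI i hi j hj hij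
    rw [← (hget x i (hI i hi)).2, ← (hget x j (hI j hj)).2]
    exact congrArg l.idxOf hij
  have hcount : ∀ b ∈ l, ∀ I : Finset ℕ, (∀ j ∈ I, j < l.length ∧
      ((l.idxOf b < j ∧ j ≤ l.idxOf b + l.length / 2) ∨ j + l.length / 2 < l.idxOf b)) →
      I.card ≤ (outSet T l.toFinset b).card := by
    intro b hb I hI
    refine Finset.card_le_card_of_injOn (fun j => l.getD j b) (fun j hj => ?_)
      (hinj b I fun j hj => (hI j hj).1)
    obtain ⟨h1, h2⟩ := hget b j (hI j hj).1
    rw [Finset.mem_coe, mem_outSet, List.mem_toFinset, hT, h2]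
    exact ⟨h1, hb, h1, (hI j hj).2⟩
  have hlow : ∀ b ∈ l, l.idxOf b + l.length / 2 < l.length →
      l.length / 2 ≤ (outSet T l.toFinset b).card := by
    intro b hb hlt
    have := hcount b hb (Finset.Ioc (l.idxOf b) (l.idxOf b + l.length / 2)) (by
      intro j hj
      rw [Finset.mem_Ioc] at hj
      omega)
    simpa using this
  refine ⟨T, fun a b hab hba => ?_, fun a b hab => ?_, fun a ha b hb h1 h2 => ?_, fun b hb => ?_,
    ?_⟩
  · rw [hT] at hab hba
    omega
  · rw [hT] at hab
    exact ⟨hab.1, hab.2.1⟩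
  · rw [hT]
    exact ⟨ha, hb, .inl ⟨h1, h2⟩⟩
  · have hlt := List.idxOf_lt_length_of_mem hb
    by_cases h : l.idxOf b + l.length / 2 < l.length
    · have := hlow b hb h
      omega
    · have := hcount b hb (Finset.Ioo (l.idxOf b) l.length ∪
          Finset.range (l.idxOf b - l.length / 2)) (by
        intro j hj
        rw [Finset.mem_union, Finset.mem_Ioo, Finset.mem_range] at hj
        omega)
      rw [Finset.card_union_of_disjoint, Nat.card_Ioo, Finset.card_range] at this
      · omega
      · rw [Finset.disjoint_left]
        intro j hj
        rw [Finset.mem_Ioo] at hj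
        rw [Finset.mem_range]
        omega
  · rcases l.eq_nil_or_concat with rfl | ⟨l', x, -⟩
    · simp
    have : (Finset.range (l.length - l.length / 2)).card ≤
        (highSet T l.toFinset l.toFinset (l.length / 2)).card := by
      refine Finset.card_le_card_of_injOn (fun j => l.getD j x) (fun j hj => ?_)
        (hinj x _ fun j hj => ?_)
      · rw [Finset.mem_coe, Finset.mem_range] at hj
        obtain ⟨h1, h2⟩ := hget x j (by omega)
        rw [Finset.mem_coe, mem_highSet, List.mem_toFinset]
        exact ⟨h1, hlow _ h1 (by rw [h2]; omega)⟩
      · rw [Finset.mem_range] at hj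
        omega
    rw [Finset.card_range] at this
    omega

/-- A nearly regular tournament on a finite set in which a given element dominates a given set of
at most half the size. -/
theorem exists_tournament {S A : Finset K} {x : K} (hx : x ∈ S) (hA : A ⊆ S) (hxA : x ∉ A)
    (hAS : A.card ≤ S.card / 2) :
    ∃ T : K → K → Prop, (∀ a b, T a b → ¬ T b a) ∧ (∀ a b, T a b → a ∈ S ∧ b ∈ S) ∧
      (∀ a ∈ A, T x a) ∧ (∀ b ∈ S, (S.card - 1) / 2 ≤ (outSet T S b).card) ∧
      (S.card + 1) / 2 ≤ (highSet T S S (S.card / 2)).card := by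
  classical
  -- The first entry beats the next |S|/2, so `A` is placed directly after `x`.
  obtain ⟨l, hl⟩ : ∃ l, l = x :: (A.toList ++ (S \ insert x A).toList) := ⟨_, rfl⟩
  have hnd : l.Nodup := by
    rw [hl, List.nodup_cons, List.nodup_append']
    refine ⟨by simp [hxA], A.nodup_toList, Finset.nodup_toList _, ?_⟩
    intro a ha hb
    simp only [Finset.mem_toList, Finset.mem_sdiff, Finset.mem_insert] at ha hb
    tauto
  have hS : l.toFinset = S := by
    ext a
    simp only [hl, List.mem_toFinset, List.mem_cons, List.mem_append, Finset.mem_toList,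
      Finset.mem_sdiff, Finset.mem_insert]
    constructor
    · rintro (rfl | h | h)
      exacts [hx, hA h, h.1]
    · tauto
  have hlen : l.length = S.card := by rw [← hS, List.toFinset_card_of_nodup hnd]
  have hmem : ∀ a, a ∈ l ↔ a ∈ S := fun a => by rw [← hS, List.mem_toFinset]
  obtain ⟨T, h1, h2, h3, h4, h5⟩ := exists_tournament_list hnd
  rw [hS, hlen] at h5
  refine ⟨T, h1, fun a b h => by simpa only [hmem] using h2 a b h, fun a ha => ?_, fun b hb => ?_,
    h5⟩
  · have hax : x ≠ a := fun h => hxA (h ▸ ha)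
    have hi : l.idxOf a ≤ A.card := by
      rw [hl, List.idxOf_cons_ne _ hax, List.idxOf_append_of_mem (by simpa using ha),
        ← Finset.length_toList]
      exact List.idxOf_lt_length_of_mem (by simpa using ha)
    refine h3 x ((hmem x).2 hx) a ((hmem a).2 (hA ha)) ?_ ?_
    · rw [hl, List.idxOf_cons_self, List.idxOf_cons_ne _ hax]
      omega
    · rw [hlen]
      omega
  · rw [← hlen, ← hS]
    exact h4 b ((hmem b).2 hb)

/-- As `exists_tournament`, but with a further element `g` dominating all others. -/
theorem exists_tournament_king {C A : Finset K} {x g : K} (hx : x ∈ C) (hg : g ∈ C) (hxg : x ≠ g)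
    (hA : A ⊆ C) (hxA : x ∉ A) (hgA : g ∉ A) (hAC : A.card ≤ (C.card - 1) / 2) :
    ∃ T : K → K → Prop, (∀ a b, T a b → ¬ T b a) ∧ (∀ a ∈ A, T x a) ∧
      (∀ a ∈ C, a ≠ g → T g a) ∧ (∀ b ∈ C, (C.card - 2) / 2 ≤ (outSet T C b).card) ∧
      ∀ S, x ∉ S → S ⊆ C → g ∉ S → S.card + 2 = C.card →
        S.card ≤ 2 * (highSet T C S ((C.card - 1) / 2)).card + 1 := by
  classical
  have hcard : (C.erase g).card = C.card - 1 := Finset.card_erase_of_mem hg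
  -- Since `g` beats everything, the regular tournament lives on the other colors.
  obtain ⟨T, h1, h2, h3, h4, h5⟩ := exists_tournament (S := C.erase g) (A := A) (x := x)
    (by simp [hx, hxg]) (fun a ha => by
      rw [Finset.mem_erase]
      exact ⟨fun h => hgA (h ▸ ha), hA ha⟩) hxA (by rwa [hcard])
  rw [hcard] at h4 h5
  obtain ⟨T', hT'⟩ : ∃ T' : K → K → Prop, ∀ a b, T' a b ↔ T a b ∨ (a = g ∧ b ∈ C ∧ b ≠ g) :=
    ⟨_, fun a b => Iff.rfl⟩
  have hnot : ∀ a, ¬ T g a ∧ ¬ T a g := fun a =>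
    ⟨fun h => by simpa using (h2 _ _ h).1, fun h => by simpa using (h2 _ _ h).2⟩
  have hsub : ∀ b, outSet T (C.erase g) b ⊆ outSet T' C b := by
    intro b a
    rw [mem_outSet, mem_outSet, hT', Finset.mem_erase]
    tauto
  refine ⟨T', fun a b hab hba => ?_, fun a ha => (hT' _ _).2 (.inl (h3 a ha)),
    fun a ha hag => (hT' _ _).2 (.inr ⟨rfl, ha, hag⟩), fun b hb => ?_, fun S hxS hSC hgS hS => ?_⟩
  · rw [hT'] at hab hba
    have := hnot a
    have := hnot b
    have := h1 a b
    rcases hab with hab | ⟨rfl, hab⟩ <;> rcases hba with hba | ⟨rfl, hba⟩ <;> tauto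
  · by_cases hbg : b = g
    · subst hbg
      have : C.erase b ⊆ outSet T' C b := fun a ha => by
        rw [Finset.mem_erase] at ha
        rw [mem_outSet, hT']
        exact ⟨ha.2, .inr ⟨rfl, ha.2, ha.1⟩⟩
      have := Finset.card_le_card this
      omega
    · have := h4 b (by simp [hb, hbg])
      have := Finset.card_le_card (hsub b)
      omega
  · have hSe : S = (C.erase g).erase x := by
      apply Finset.eq_of_subset_of_card_le
      · intro a ha
        simp only [Finset.mem_erase]
        refine ⟨?_, ?_, hSC ha⟩ <;> rintro rfl <;> tauto
      · rw [Finset.card_erase_of_mem (by simp [hx, hxg]), hcard]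
        omega
    have : (highSet T (C.erase g) (C.erase g) ((C.card - 1) / 2)).erase x ⊆
        highSet T' C S ((C.card - 1) / 2) := by
      intro a
      rw [Finset.mem_erase, mem_highSet, mem_highSet, hSe]
      exact fun h => ⟨Finset.mem_erase.2 ⟨h.1, h.2.1⟩, h.2.2.trans (Finset.card_le_card (hsub a))⟩
    have := Finset.card_le_card this
    have := Finset.pred_card_le_card_erase
      (s := highSet T (C.erase g) (C.erase g) ((C.card - 1) / 2)) (a := x)
    omega

/-- A set of `D` elements that contains `e` and a given set `B` outside `C ∪ X`, and that meets `C`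
apart from `e` in `t` elements of `O`. -/
theorem exists_palette [Fintype K] [DecidableEq K] {C O X B : Finset K} {e : K} {D t : ℕ}
    (he : e ∈ C) (heO : e ∉ O) (hO : O ⊆ C) (ht : t ≤ O.card) (htD : t + 1 ≤ D)
    (hD : D + (C ∪ X).card ≤ Fintype.card K + t + 1) (hB : Disjoint B (C ∪ X))
    (hBD : B.card + t + 1 ≤ D) :
    ∃ C' A : Finset K, C'.card = D ∧ e ∈ C' ∧ B ⊆ C' ∧ A ⊆ O ∧ A.card = t ∧ A ⊆ C' ∧
      (∀ a ∈ C', a ∈ C → a ≠ e → a ∈ A) ∧ ∀ a ∈ C', a ∈ X → a ∈ C := by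
  obtain ⟨A, hAO, hA⟩ := Finset.exists_subset_card_eq ht
  have hBc : B ⊆ (C ∪ X)ᶜ := fun a ha => by
    rw [Finset.mem_compl]
    exact Finset.disjoint_left.1 hB ha
  -- Besides `e` and the t colors of `A`, the rest is taken outside `C ∪ X`, where `hD` leaves
  -- enough room.
  obtain ⟨F, hBF, hF, hFc⟩ := Finset.exists_subsuperset_card_eq (n := D - (t + 1)) hBc
    (by omega) (by rw [Finset.card_compl]; omega)
  have hFn : ∀ a ∈ F, a ∉ C ∧ a ∉ X := fun a ha => by
    have := hF ha
    simpa using this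
  refine ⟨insert e (A ∪ F), A, ?_, by simp, fun a ha => by simp [hBF ha], hAO, hA,
    fun a ha => by simp [ha], ?_, ?_⟩
  · rw [Finset.card_insert_of_notMem, Finset.card_union_of_disjoint]
    · omega
    · rw [Finset.disjoint_left]
      exact fun a ha haF => (hFn a haF).1 (hO (hAO ha))
    · rw [Finset.mem_union, not_or]
      exact ⟨fun h => heO (hAO h), fun h => (hFn e h).1 he⟩
  · intro a ha haC hae
    simp only [Finset.mem_insert, Finset.mem_union] at ha
    rcases ha with h | h | h
    exacts [absurd h hae, h, absurd haC (hFn a h).1]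
  · intro a ha haX
    simp only [Finset.mem_insert, Finset.mem_union] at ha
    rcases ha with rfl | h | h
    exacts [he, hO (hAO h), absurd haX (hFn a h).2]

end SimpleGraph

/-! ### Schemes, and extension by a leaf. -/

namespace SimpleGraph

variable {V K : Type*} {G H H' : SimpleGraph V} {D : ℕ}

/-- A star edge coloring `c` of `H` together with the data needed to extend it: every vertex `v`
has a palette `C v` of `D` colors containing the colors at `v`, an asymmetric relation `T v` on
colors such that the color of an edge `vw` dominates all other common colors of `C v` and `C w`,
and a set `Av v` of unused colors which are available for further edges at `v`. -/
structure Scheme (H : SimpleGraph V) (K : Type*) (D : ℕ) where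
  c : V → V → K
  C : V → Finset K
  T : V → K → K → Prop
  Av : V → Finset K
  c_symm : ∀ v w, c v w = c w v
  card_C : ∀ v, (C v).card = D
  mem_C : ∀ v w, H.Adj v w → c v w ∈ C v
  proper : ∀ v w w', H.Adj v w → H.Adj v w' → c v w = c v w' → w = w'
  asymm : ∀ v a b, T v a b → ¬ T v b a
  dominates : ∀ v w, H.Adj v w → ∀ a ∈ C v, a ∈ C w → a ≠ c v w → T v (c v w) a
  av_subset : ∀ v, Av v ⊆ C v
  av_unused : ∀ v w, H.Adj v w → c v w ∉ Av v
  -- With D + D/2 + 1 colors in all, a palette across an edge of color b needs D - 1 - (D/2 + 1)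
  -- colors dominated by b, which is at most this bound.
  le_card_outSet : ∀ v, ∀ b ∈ Av v, (D - 3) / 2 ≤ (outSet (T v) (C v) b).card
  -- This provides a high color whenever two colors are available, as a cycle requires.
  balanced : ∀ v, (Av v).card ≤ 2 * (highSet (T v) (C v) (Av v) ((D - 1) / 2)).card + 1

namespace Scheme

/-- A scheme with fewer edges and fewer available colors. -/
def shrink (S : Scheme H K D) (h : H' ≤ H) (Av : V → Finset K) (hAv : ∀ v, Av v ⊆ S.Av v)
    (hbal : ∀ v, (Av v).card ≤ 2 * (highSet (S.T v) (S.C v) (Av v) ((D - 1) / 2)).card + 1) :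
    Scheme H' K D where
  c := S.c
  C := S.C
  T := S.T
  Av := Av
  c_symm := S.c_symm
  card_C := S.card_C
  mem_C v w hvw := S.mem_C v w (h hvw)
  proper v w w' hw hw' := S.proper v w w' (h hw) (h hw')
  asymm := S.asymm
  dominates v w hvw := S.dominates v w (h hvw)
  av_subset v := (hAv v).trans (S.av_subset v)
  av_unused v w hvw hc := S.av_unused v w (h hvw) (hAv v hc)
  le_card_outSet v b hb := S.le_card_outSet v b (hAv v hb)
  balanced := hbal

/-- Joining a vertex `w` to a graph with a scheme. -/
theorem exists_extend (S : Scheme H K D) {w : V}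
    (hH : ∀ y z, y ≠ w → z ≠ w → H'.Adj y z → H.Adj y z) (b : V → K)
    {C : Finset K} {T : K → K → Prop} {Av : Finset K}
    (hC : C.card = D) (hbC : ∀ v, H'.Adj w v → b v ∈ C) (hbAv : ∀ v, H'.Adj w v → b v ∉ Av)
    (hbCv : ∀ v, H'.Adj w v → b v ∈ S.C v) (hbAvv : ∀ v, H'.Adj w v → b v ∉ S.Av v)
    (hunused : ∀ v, H'.Adj w v → ∀ y, y ≠ w → H'.Adj v y → S.c v y ≠ b v)
    (hT : ∀ v, H'.Adj w v → ∀ a ∈ S.C v, a ∈ C → a ≠ b v → S.T v (b v) a ∧ T (b v) a)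
    (hinj : ∀ v v', H'.Adj w v → H'.Adj w v' → b v = b v' → v = v')
    (hasymm : ∀ a b, T a b → ¬ T b a) (hAv : Av ⊆ C)
    (hout : ∀ a ∈ Av, (D - 3) / 2 ≤ (outSet T C a).card)
    (hbal : Av.card ≤ 2 * (highSet T C Av ((D - 1) / 2)).card + 1) :
    ∃ S' : Scheme H' K D, (∀ v, v ≠ w → S'.C v = S.C v ∧ S'.T v = S.T v ∧ S'.Av v = S.Av v) ∧
      S'.C w = C ∧ S'.T w = T ∧ S'.Av w = Av ∧ (∀ v, S'.c w v = b v) ∧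
      ∀ y z, y ≠ w → z ≠ w → S'.c y z = S.c y z := by
  classical
  obtain ⟨c, hcw, hcw', hc⟩ : ∃ c : V → V → K, (∀ v, c w v = b v) ∧ (∀ v, c v w = b v) ∧
      ∀ y z, y ≠ w → z ≠ w → c y z = S.c y z := by
    refine ⟨fun y z => if y = w then b z else if z = w then b y else S.c y z, ?_, ?_, ?_⟩
    · simp
    · intro v
      by_cases h : v = w <;> simp [h]
    · intro y z hy hz
      simp [hy, hz]
  have hne : ∀ {v}, H'.Adj w v → v ≠ w := fun h => h.ne'
  refine ⟨{
    c := c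
    C := Function.update S.C w C
    T := Function.update S.T w T
    Av := Function.update S.Av w Av
    c_symm := ?_, card_C := ?_, mem_C := ?_, proper := ?_, asymm := ?_, dominates := ?_
    av_subset := ?_, av_unused := ?_, le_card_outSet := ?_, balanced := ?_ }, ?_⟩
  · intro y z
    by_cases hy : y = w
    · subst hy
      rw [hcw, hcw']
    by_cases hz : z = w
    · subst hz
      rw [hcw, hcw']
    rw [hc y z hy hz, hc z y hz hy, S.c_symm]
  · intro v
    by_cases hv : v = w
    · subst hv
      simpa using hC
    · simpa [hv] using S.card_C v
  · intro v y hvy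
    by_cases hv : v = w
    · subst hv
      simpa [hcw] using hbC y hvy
    by_cases hy : y = w
    · subst hy
      simpa [hcw', hv] using hbCv v hvy.symm
    · simpa [hc v y hv hy, hv] using S.mem_C v y (hH v y hv hy hvy)
  · intro v y z hvy hvz h
    by_cases hv : v = w
    · subst hv
      rw [hcw, hcw] at h
      exact hinj y z hvy hvz h
    by_cases hy : y = w <;> by_cases hz : z = w
    · rw [hy, hz]
    · subst hy
      rw [hcw', hc v z hv hz] at h
      exact absurd h.symm (hunused v hvy.symm z hz hvz)
    · subst hz
      rw [hcw', hc v y hv hy] at h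
      exact absurd h (hunused v hvz.symm y hy hvy)
    · rw [hc v y hv hy, hc v z hv hz] at h
      exact S.proper v y z (hH v y hv hy hvy) (hH v z hv hz hvz) h
  · intro v
    by_cases hv : v = w
    · subst hv
      simpa using hasymm
    · simpa [hv] using S.asymm v
  · intro v y hvy a
    by_cases hv : v = w
    · subst hv
      simp only [hcw, Function.update_self, Function.update_of_ne (hne hvy)]
      exact fun ha ha' hab => (hT y hvy a ha' ha hab).2
    by_cases hy : y = w
    · subst hy
      simp only [hcw', Function.update_self, Function.update_of_ne hv]
      exact fun ha ha' hab => (hT v hvy.symm a ha ha' hab).1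
    · simp only [hc v y hv hy, Function.update_of_ne hv, Function.update_of_ne hy]
      exact S.dominates v y (hH v y hv hy hvy) a
  · intro v
    by_cases hv : v = w
    · subst hv
      simpa using hAv
    · simpa [hv] using S.av_subset v
  · intro v y hvy
    by_cases hv : v = w
    · subst hv
      simpa [hcw] using hbAv y hvy
    by_cases hy : y = w
    · subst hy
      simpa [hcw', hv] using hbAvv v hvy.symm
    · simpa [hc v y hv hy, hv] using S.av_unused v y (hH v y hv hy hvy)
  · intro v
    by_cases hv : v = w
    · subst hv
      simpa using hout
    · simpa [hv] using S.le_card_outSet v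
  · intro v
    by_cases hv : v = w
    · subst hv
      simpa using hbal
    · simpa [hv] using S.balanced v
  · refine ⟨fun v hv => by simp [hv], by simp, by simp, by simp, hcw, hc⟩

end Scheme

/-- Removing a suitable element from a set keeps it balanced. -/
theorem exists_balanced_erase [DecidableEq K] {T : K → K → Prop} {C S : Finset K} {s m n : ℕ}
    (hS : S.Nonempty) (hm : S.card ≤ m + 1) (hn : n ≤ (highSet T C S s).card) (hmn : m ≤ 2 * n + 1) :
    ∃ b ∈ S, (S.erase b).card ≤ 2 * (highSet T C (S.erase b) s).card + 1 := by
  -- Removing a low element keeps all high ones; if there is no low element, any choice works.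
  by_cases h : ∃ b ∈ S, b ∉ highSet T C S s
  · obtain ⟨b, hb, hb'⟩ := h
    refine ⟨b, hb, ?_⟩
    have : highSet T C (S.erase b) s = highSet T C S s := by
      ext a
      rw [mem_highSet, mem_highSet, Finset.mem_erase]
      constructor
      · tauto
      · exact fun ha => ⟨⟨fun hab => hb' (mem_highSet.2 (hab ▸ ha)), ha.1⟩, ha.2⟩
    rw [this, Finset.card_erase_of_mem hb]
    omega
  · push Not at h
    obtain ⟨b, hb⟩ := hS
    refine ⟨b, hb, ?_⟩
    have : highSet T C (S.erase b) s = S.erase b := by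
      ext a
      rw [mem_highSet, Finset.mem_erase]
      exact ⟨And.left, fun ha => ⟨ha, (mem_highSet.1 (h a ha.2)).2⟩⟩
    rw [this]
    omega

/-- Removing two suitable elements, one of them high, from a set keeps it balanced. -/
theorem exists_balanced_erase_erase [DecidableEq K] {T : K → K → Prop} {C S : Finset K} {s : ℕ}
    (hS : 2 ≤ S.card) (hbal : S.card ≤ 2 * (highSet T C S s).card + 1) :
    ∃ a ∈ S, ∃ b ∈ S, a ≠ b ∧ s ≤ (outSet T C a).card ∧
      ((S.erase a).erase b).card ≤ 2 * (highSet T C ((S.erase a).erase b) s).card + 1 := by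
  obtain ⟨a, ha⟩ : (highSet T C S s).Nonempty := by
    rw [← Finset.card_pos]
    omega
  have haS := (mem_highSet.1 ha).1
  have hhigh : highSet T C (S.erase a) s = (highSet T C S s).erase a := by
    ext k
    rw [mem_highSet, Finset.mem_erase, Finset.mem_erase, mem_highSet, and_assoc]
  have h1 := Finset.card_erase_of_mem ha
  have h2 := Finset.card_erase_of_mem haS
  have h3 := Finset.card_pos.2 ⟨a, ha⟩
  obtain ⟨b, hb, hb'⟩ := exists_balanced_erase (T := T) (C := C) (S := S.erase a) (s := s)
    (m := S.card - 2) (n := (highSet T C S s).card - 1)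
    (by rw [← Finset.card_pos]; omega) (by omega) (by rw [hhigh, h1]) (by omega)
  rw [Finset.mem_erase] at hb
  exact ⟨a, haS, b, hb.2, hb.1.symm, (mem_highSet.1 ha).2, hb'⟩

namespace Scheme

theorem notMem_outSet_self (S : Scheme H K D) (v : V) (b : K) :
    b ∉ outSet (S.T v) (S.C v) b := fun h =>
  S.asymm v b b (mem_outSet.1 h).2 (mem_outSet.1 h).2

theorem outSet_subset (S : Scheme H K D) (v : V) (b : K) :
    outSet (S.T v) (S.C v) b ⊆ S.C v := fun _ h => (mem_outSet.1 h).1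

/-- Adding a leaf. -/
theorem exists_addLeaf [Fintype K] (hK : Fintype.card K = D + D / 2 + 1) (hD : 1 ≤ D)
    (S : Scheme H K D) {u w : V}
    (hH : ∀ y z, y ≠ w → z ≠ w → H'.Adj y z → H.Adj y z) (hw : ∀ y, H'.Adj w y → y = u)
    (huw : u ≠ w) (hu : (S.Av u).Nonempty) (hHH' : ∀ y, y ≠ w → H'.Adj u y → H.Adj u y) :
    ∃ S' : Scheme H' K D, (∀ v, v ≠ u → v ≠ w → S'.Av v = S.Av v) ∧
      (S.Av u).card ≤ (S'.Av u).card + 1 ∧ D ≤ (S'.Av w).card + 1 := by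
  classical
  obtain ⟨b, hb, hbal⟩ := exists_balanced_erase hu (Nat.le_succ _) le_rfl (S.balanced u)
  have hbC := S.av_subset u hb
  obtain ⟨C, A, hC, hbC', -, hAO, hA, hAC, hCA, -⟩ := exists_palette (X := ∅) (B := ∅) (D := D)
    hbC (S.notMem_outSet_self u b) (S.outSet_subset u b) (S.le_card_outSet u b hb)
    (by omega) (by rw [Finset.union_empty, S.card_C, hK]; omega) (by simp) (by simp; omega)
  have hbA : b ∉ A := fun h => S.notMem_outSet_self u b (hAO h)
  obtain ⟨T, hT1, -, hT2, hT3, hT4⟩ := exists_tournament hbC' hAC hbA (by omega)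
  rw [hC] at hT3 hT4
  have hAv : ∀ v, Function.update S.Av u ((S.Av u).erase b) v ⊆ S.Av v := by
    intro v
    by_cases hv : v = u
    · subst hv
      simpa using Finset.erase_subset _ _
    · simp [hv]
  have hhigh : (highSet T C C (D / 2)).erase b ⊆ highSet T C (C.erase b) ((D - 1) / 2) := by
    intro a
    rw [Finset.mem_erase, mem_highSet, mem_highSet, Finset.mem_erase]
    exact fun h => ⟨⟨h.1, h.2.1⟩, by omega⟩
  have hcard : (C.erase b).card = D - 1 := by rw [Finset.card_erase_of_mem hbC', hC]
  obtain ⟨S', h1, h2, h3, h4, h5, h6⟩ := exists_extend (H' := H') (w := w)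
    (S.shrink le_rfl (Function.update S.Av u ((S.Av u).erase b)) hAv (by
      intro v
      by_cases hv : v = u
      · subst hv
        simpa using hbal
      · simpa [hv] using S.balanced v))
    hH (fun _ => b) (C := C) (T := T) (Av := C.erase b) hC (fun _ _ => hbC') (by simp)
    (fun v hv => by rw [hw v hv]; exact hbC)
    (fun v hv => by rw [hw v hv]; simp [shrink])
    (fun v hv y hy hvy hc => by
      rw [hw v hv] at hvy hc
      exact S.av_unused u y (hHH' y hy hvy) (hc ▸ hb))
    (fun v hv a ha ha' hab => by
      rw [hw v hv] at ha ⊢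
      have := hCA a ha' ha hab
      exact ⟨(mem_outSet.1 (hAO this)).2, hT2 a this⟩)
    (fun v v' hv hv' _ => (hw v hv).trans (hw v' hv').symm) hT1 (Finset.erase_subset _ _)
    (fun a ha => le_trans (by omega) (hT3 a (Finset.mem_of_mem_erase ha)))
    (by
      have := Finset.card_le_card hhigh
      have := Finset.pred_card_le_card_erase (s := highSet T C C (D / 2)) (a := b)
      omega)
  refine ⟨S', fun v hvu hvw => ?_, ?_, ?_⟩
  · rw [(h1 v hvw).2.2]
    simp [shrink, hvu]
  · rw [(h1 u huw).2.2]
    simp only [shrink, Function.update_self]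
    rw [Finset.card_erase_of_mem hb]
    omega
  · rw [h4]
    omega

/-- Adding a leaf whose edge gets the color `g`, with a further color `k` at the leaf dominating
all others. -/
theorem exists_addLeaf_king [Fintype K] (hD : 2 ≤ D)
    (S : Scheme H K D) {u w : V}
    (hH : ∀ y z, y ≠ w → z ≠ w → H'.Adj y z → H.Adj y z) (hw : ∀ y, H'.Adj w y → y = u)
    {g k : K} (hg : g ∈ S.C u) (hgAv : g ∉ S.Av u)
    (hgu : ∀ y, y ≠ w → H'.Adj u y → S.c u y ≠ g)
    (hgo : (D - 1) / 2 ≤ (outSet (S.T u) (S.C u) g).card) (X : Set K) (hk : k ∉ S.C u) (hkX : k ∉ X)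
    (hX : ∃ f, ∀ a ∈ X, a = f) (hK : Fintype.card K = D + D / 2 + 1) :
    ∃ S' : Scheme H' K D,
      (∀ v, v ≠ w → S'.C v = S.C v ∧ S'.T v = S.T v ∧ S'.Av v = S.Av v) ∧
      (∀ v, S'.c w v = g) ∧ (∀ y z, y ≠ w → z ≠ w → S'.c y z = S.c y z) ∧
      D ≤ (S'.Av w).card + 2 ∧ (∀ a ∈ S'.C w, a ∈ X → a ∈ S.C u) ∧ k ∈ S'.C w ∧ k ∉ S'.Av w ∧
      ∀ a ∈ S'.C w, a ≠ k → S'.T w k a := by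
  classical
  obtain ⟨f, hf⟩ := hX
  obtain ⟨X', hX'⟩ : ∃ X' : Finset K, ∀ a, a ∈ X' ↔ a ∈ X := by
    refine ⟨({f} : Finset K).filter (· ∈ X), fun a => ?_⟩
    rw [Finset.mem_filter, Finset.mem_singleton]
    exact ⟨And.right, fun h => ⟨hf a h, h⟩⟩
  have hX'c : X'.card ≤ 1 := by
    rw [Finset.card_le_one]
    exact fun a ha b hb => (hf a ((hX' a).1 ha)).trans (hf b ((hX' b).1 hb)).symm
  have hun := Finset.card_union_le (S.C u) X'
  rw [S.card_C] at hun
  -- The bound `hgo` exactly pays for the one additional color of `X'` to be avoided.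
  obtain ⟨C, A, hC, hgC, hkC, hAO, hA, hAC, hCA, hCX⟩ := exists_palette (X := X') (B := {k})
    (D := D) hg (S.notMem_outSet_self u g) (S.outSet_subset u g) hgo
    (by omega) (by omega) (by simp [hk, hX', hkX]) (by simp; omega)
  rw [Finset.singleton_subset_iff] at hkC
  have hgA : g ∉ A := fun h => S.notMem_outSet_self u g (hAO h)
  have hkA : k ∉ A := fun h => hk (S.outSet_subset u g (hAO h))
  have hgk : g ≠ k := fun h => hk (h ▸ hg)
  obtain ⟨T, hT1, hT2, hT3, hT4, hT5⟩ := exists_tournament_king hgC hkC hgk hAC hgA hkA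
    (by omega)
  rw [hC] at hT4 hT5
  have hcard : ((C.erase g).erase k).card + 2 = D := by
    rw [Finset.card_erase_of_mem (by simp [hkC, hgk.symm]), Finset.card_erase_of_mem hgC, hC]
    omega
  have hsub : (C.erase g).erase k ⊆ C := (Finset.erase_subset _ _).trans (Finset.erase_subset _ _)
  obtain ⟨S', h1, h2, h3, h4, h5, h6⟩ := S.exists_extend (H' := H') (w := w)
    hH (fun _ => g) (C := C) (T := T) (Av := (C.erase g).erase k) hC (fun _ _ => hgC) (by simp)
    (fun v hv => by rw [hw v hv]; exact hg)
    (fun v hv => by rw [hw v hv]; exact hgAv)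
    (fun v hv => by rw [hw v hv]; exact hgu)
    (fun v hv a ha ha' hab => by
      rw [hw v hv] at ha ⊢
      have := hCA a ha' ha hab
      exact ⟨(mem_outSet.1 (hAO this)).2, hT2 a this⟩)
    (fun v v' hv hv' _ => (hw v hv).trans (hw v' hv').symm) hT1 hsub
    (fun a ha => le_trans (by omega) (hT4 a (hsub ha)))
    (hT5 _ (by simp) hsub (by simp) hcard)
  refine ⟨S', h1, h5, h6, ?_, ?_, ?_, ?_, ?_⟩
  · rw [h4]
    omega
  · rw [h2]
    exact fun a ha haX => hCX a ha ((hX' a).2 haX)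
  · rw [h2]
    exact hkC
  · rw [h4]
    simp
  · rw [h2, h3]
    exact hT3

end Scheme
end SimpleGraph

/-! ### Extension by a path and by a cycle. -/

namespace SimpleGraph

variable {V K : Type*} {G H : SimpleGraph V} {D : ℕ}

/-- The graph `H` together with the edges of a walk. -/
def addWalk (H : SimpleGraph V) {G : SimpleGraph V} {w x : V} (p : G.Walk w x) : SimpleGraph V where
  Adj y z := H.Adj y z ∨ s(y, z) ∈ p.edges
  symm := ⟨fun y z h => h.imp (fun h => h.symm) fun h => by rwa [Sym2.eq_swap]⟩
  loopless := ⟨fun y h => h.elim (fun h => h.ne rfl) fun h => (p.adj_of_mem_edges h).ne rfl⟩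

theorem addWalk_adj {w x : V} {p : G.Walk w x} {y z : V} :
    (H.addWalk p).Adj y z ↔ H.Adj y z ∨ s(y, z) ∈ p.edges := Iff.rfl

namespace Scheme

/-- `S'` extends `S` along the walk `p`, keeping the color `β` unused at the last vertex. -/
structure Extends (S : Scheme H K D) {w x : V} (p : G.Walk w x) (β : K)
    (S' : Scheme (H.addWalk p) K D) : Prop where
  C_eq : S'.C x = S.C x
  T_eq : S'.T x = S.T x
  Av_eq : ∀ v, v ∉ p.support ∨ v = x → S'.Av v = S.Av v
  card_Av : ∀ z ∈ p.support, z ≠ x → D ≤ (S'.Av z).card + 2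
  unused : ∀ y, (H.addWalk p).Adj x y → S'.c x y ≠ β

/-- One step along the path: ww' gets the color `g`, and `k` becomes king at w. As `g` must dominate
the colors common to both palettes, the king has to lie outside the palette of w'. -/
theorem Extends.exists_cons [Fintype K] (hK : Fintype.card K = D + D / 2 + 1) (hD : 2 ≤ D)
    {S : Scheme H K D} {w w' x : V} {p : G.Walk w' x} {β : K} {S₁ : Scheme (H.addWalk p) K D}
    (hS₁ : S.Extends p β S₁) (h : G.Adj w w') (hp : (Walk.cons h p).IsPath)
    (hw : ∀ y, ¬ H.Adj w y) {g k : K} (hg : g ∈ S₁.C w') (hgAv : g ∉ S₁.Av w')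
    (hgu : ∀ y, (H.addWalk p).Adj w' y → S₁.c w' y ≠ g)
    (hgo : (D - 1) / 2 ≤ (outSet (S₁.T w') (S₁.C w') g).card) (hgβ : w' = x → g ≠ β)
    (hk : k ∉ S₁.C w') (X : Set K) (hkX : k ∉ X) (hX : ∃ f, ∀ a ∈ X, a = f) :
    ∃ S' : Scheme (H.addWalk (Walk.cons h p)) K D, S.Extends (.cons h p) β S' ∧
      (∀ a ∈ S'.C w, a ∈ X → a ∈ S₁.C w') ∧ k ∈ S'.C w ∧ k ∉ S'.Av w ∧
      (∀ y, (H.addWalk (Walk.cons h p)).Adj w y → S'.c w y ≠ k) ∧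
      ∀ a ∈ S'.C w, a ≠ k → S'.T w k a := by
  obtain ⟨hp', hwp⟩ := (Walk.cons_isPath_iff h p).1 hp
  have hxw : x ≠ w := fun hx => hwp (hx ▸ p.end_mem_support)
  have hadj : ∀ y z, y ≠ w → z ≠ w → (H.addWalk (Walk.cons h p)).Adj y z →
      (H.addWalk p).Adj y z := by
    intro y z hy hz hyz
    rw [addWalk_adj, Walk.edges_cons, List.mem_cons, Sym2.eq_iff] at hyz
    rw [addWalk_adj]
    tauto
  have hadjw : ∀ y, (H.addWalk (Walk.cons h p)).Adj w y → y = w' := by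
    intro y hy
    rw [addWalk_adj, Walk.edges_cons, List.mem_cons, Sym2.eq_iff] at hy
    rcases hy with hy | (hy | hy) | hy
    · exact absurd hy (hw y)
    · exact hy.2
    · exact absurd hy.1 h.ne
    · exact absurd (p.fst_mem_support_of_mem_edges hy) hwp
  obtain ⟨S', h1, h2, h3, h4, h5, h6, h7, h8⟩ := S₁.exists_addLeaf_king hD hadj hadjw hg hgAv
    (fun y hy hwy => hgu y (hadj w' y h.ne' hy hwy)) hgo X hk hkX hX hK
  refine ⟨S', ⟨?_, ?_, fun v hv => ?_, fun z hz hzx => ?_, fun y hy => ?_⟩, h5, h6, h7, ?_, h8⟩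
  · rw [(h1 x hxw).1, hS₁.C_eq]
  · rw [(h1 x hxw).2.1, hS₁.T_eq]
  · have hvw : v ≠ w := by
      rintro rfl
      rcases hv with hv | hv
      · exact hv (by simp)
      · exact hxw hv.symm
    rw [(h1 v hvw).2.2, hS₁.Av_eq]
    refine hv.imp_left fun hv hv' => hv ?_
    rw [Walk.support_cons]
    exact List.mem_cons_of_mem _ hv'
  · by_cases hzw : z = w
    · rw [hzw]
      exact h4
    · rw [Walk.support_cons, List.mem_cons] at hz
      rw [(h1 z hzw).2.2]
      exact hS₁.card_Av z (hz.resolve_left hzw) hzx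
  · by_cases hyw : y = w
    · subst hyw
      rw [S'.c_symm, h2]
      exact hgβ (hadjw x hy.symm).symm
    · rw [h3 x y hxw hyw]
      exact hS₁.unused y (hadj x y hxw hyw hy)
  · intro y _ hy
    rw [h2] at hy
    exact hk (hy ▸ hg)

/-- Adding a path that starts at `x` with the color `α`. -/
theorem exists_addWalk [Fintype K] (hK : Fintype.card K = D + D / 2 + 1) (hD : 2 ≤ D)
    (S : Scheme H K D) {x : V} {α β f : K} (hα : α ∈ S.C x) (hαAv : α ∉ S.Av x)
    (hαu : ∀ y, H.Adj x y → S.c x y ≠ α) (hβu : ∀ y, H.Adj x y → S.c x y ≠ β) (hαβ : α ≠ β)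
    (hαo : (D - 1) / 2 ≤ (outSet (S.T x) (S.C x) α).card) (hf : f ∉ S.C x) {w : V}
    (p : G.Walk w x) (hp : p.IsPath) (hpH : ∀ z ∈ p.support, z ≠ x → ∀ y, ¬ H.Adj z y) :
    ∃ S' : Scheme (H.addWalk p) K D, S.Extends p β S' ∧ f ∉ S'.C w ∧ ∃ g ∈ S'.C w, g ∉ S'.Av w ∧
      (∀ y, (H.addWalk p).Adj w y → S'.c w y ≠ g) ∧
      (D - 1) / 2 ≤ (outSet (S'.T w) (S'.C w) g).card ∧ (w = x → g ≠ β) := by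
  classical
  induction p with
  | @nil x =>
    have hle : H.addWalk (Walk.nil : G.Walk x x) ≤ H := fun y z hyz => by
      simpa [addWalk_adj] using hyz
    exact ⟨S.shrink hle S.Av (fun _ => le_rfl) S.balanced,
      ⟨rfl, rfl, fun _ _ => rfl, by simp, fun y hy => hβu y (hle hy)⟩, hf, α, hα, hαAv,
      fun y hy => hαu y (hle hy), hαo, fun _ => hαβ⟩
  | @cons w w' x h p ih =>
    obtain ⟨S₁, hS₁, hf₁, g, hg, hgAv, hgu, hgo, hgβ⟩ := ih hα hαAv hαu hβu hαo hf hp.of_cons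
      fun z hz => hpH z (by simp [hz])
    have hwx : w ≠ x := by
      rintro rfl
      exact ((Walk.cons_isPath_iff h p).1 hp).2 p.end_mem_support
    -- The color `f` is reserved for the edge preceding the closing one, so it is not used as a king
    -- here.
    obtain ⟨k, hk, hkf⟩ : ∃ k, k ∉ S₁.C w' ∧ k ≠ f := by
      have : (insert f (S₁.C w')).card < Fintype.card K := by
        refine (Finset.card_insert_le _ _).trans_lt ?_
        rw [S₁.card_C]
        omega
      obtain ⟨k, hk⟩ := Finset.exists_mem_notMem_of_card_lt_card
        (s := insert f (S₁.C w')) (t := Finset.univ) (by simpa using this)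
      simp only [Finset.mem_insert, not_or] at hk
      exact ⟨k, hk.2.2, hk.2.1⟩
    obtain ⟨S', hS', h1, h2, h3, h4, h5⟩ := hS₁.exists_cons hK hD h hp
      (hpH w (by simp) hwx) hg hgAv hgu hgo hgβ hk {f} (by simpa using hkf) ⟨f, by simp⟩
    refine ⟨S', hS', fun hf => hf₁ (h1 f hf rfl), k, h2, h3, h4, ?_, fun h => absurd h hwx⟩
    -- A king dominates D - 1 colors, hence is high and can color the next edge.
    have : (S'.C w).erase k ⊆ outSet (S'.T w) (S'.C w) k := fun a ha => by
      rw [Finset.mem_erase] at ha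
      exact mem_outSet.2 ⟨ha.2, h5 a ha.2 ha.1⟩
    have := Finset.card_le_card this
    rw [Finset.card_erase_of_mem h2, S'.card_C] at this
    omega

/-- Adding a cycle `b, y, y', …, x` whose vertices other than `x` have degree two. -/
theorem exists_addCycle [Fintype K] (hK : Fintype.card K = D + D / 2 + 1) (hD : 2 ≤ D)
    (S : Scheme H K D) {x b y y' : V} (hx : 2 ≤ (S.Av x).card) (hby : G.Adj b y)
    (hyy' : G.Adj y y') (p : G.Walk y' x) (hp : (Walk.cons hby (.cons hyy' p)).IsPath)
    (hpH : ∀ z ∈ (Walk.cons hby (.cons hyy' p)).support, z ≠ x → ∀ v, ¬ H.Adj z v)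
    (hGH : ∀ u v, u ≠ b → v ≠ b → G.Adj u v → (H.addWalk (Walk.cons hyy' p)).Adj u v)
    (hb : ∀ v, G.Adj b v → v = y ∨ v = x) :
    ∃ S' : Scheme G K D, (∀ v, v ∉ (Walk.cons hby (.cons hyy' p)).support → S'.Av v = S.Av v) ∧
      (S.Av x).card ≤ (S'.Av x).card + 2 ∧
      ∀ z ∈ (Walk.cons hby (.cons hyy' p)).support, z ≠ x → D ≤ (S'.Av z).card + 2 := by
  classical
  obtain ⟨hp₁, hbp⟩ := (Walk.cons_isPath_iff _ _).1 hp
  obtain ⟨hp₂, hyp⟩ := (Walk.cons_isPath_iff _ _).1 hp₁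
  have hxy : x ≠ y := fun h => hyp (h ▸ p.end_mem_support)
  have hxb : x ≠ b := fun h => hbp (h ▸ Walk.end_mem_support _)
  obtain ⟨α, hα, β, hβ, hαβ, hαo, hbal⟩ := exists_balanced_erase_erase hx (S.balanced x)
  obtain ⟨f, hf⟩ : ∃ f, f ∉ S.C x := by
    obtain ⟨k, hk⟩ := Finset.exists_mem_notMem_of_card_lt_card
      (s := S.C x) (t := Finset.univ) (by rw [Finset.card_univ, S.card_C]; omega)
    exact ⟨k, hk.2⟩
  have hβC := S.av_subset x hβ
  have hβo := S.le_card_outSet x β hβ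
  have hAv : ∀ v, Function.update S.Av x (((S.Av x).erase α).erase β) v ⊆ S.Av v := by
    intro v
    by_cases hv : v = x
    · subst hv
      simpa using (Finset.erase_subset _ _).trans (Finset.erase_subset _ _)
    · simp [hv]
  obtain ⟨S₀, hS₀⟩ : ∃ S₀, S₀ = S.shrink le_rfl
      (Function.update S.Av x (((S.Av x).erase α).erase β)) hAv (by
        intro v
        by_cases hv : v = x
        · subst hv
          simpa using hbal
        · simpa [hv] using S.balanced v) := ⟨_, rfl⟩
  have hC₀ : S₀.C = S.C := by rw [hS₀]; rfl
  have hT₀ : S₀.T = S.T := by rw [hS₀]; rfl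
  have hc₀ : S₀.c = S.c := by rw [hS₀]; rfl
  have hAv₀ : S₀.Av x = ((S.Av x).erase α).erase β := by rw [hS₀]; simp [shrink]
  have hAv₀' : ∀ v, v ≠ x → S₀.Av v = S.Av v := fun v hv => by rw [hS₀]; simp [shrink, hv]
  obtain ⟨S₁, hS₁, hf₁, g, hg, hgAv, hgu, hgo, hgβ⟩ := S₀.exists_addWalk hK hD (x := x) (α := α)
    (β := β) (f := f) (by rw [hC₀]; exact S.av_subset x hα) (by simp [hAv₀])
    (fun v hv h => S.av_unused x v hv (by rw [← hc₀, h]; exact hα))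
    (fun v hv h => S.av_unused x v hv (by rw [← hc₀, h]; exact hβ)) hαβ
    (by rw [hC₀, hT₀]; exact hαo) (by rw [hC₀]; exact hf) p hp₂
    (fun z hz => hpH z (by simp [hz]))
  -- At y the king is `f` itself, so nothing has to be avoided any more.
  obtain ⟨S₂, hS₂, -, hfC, hfAv, hfu, hfT⟩ := hS₁.exists_cons hK hD hyy' hp₁
    (hpH y (by simp) hxy.symm) hg hgAv hgu hgo hgβ hf₁ ∅ (by simp) ⟨f, by simp⟩
  have hC₂ : S₂.C x = S.C x := by rw [hS₂.C_eq, hC₀]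
  have hT₂ : S₂.T x = S.T x := by rw [hS₂.T_eq, hT₀]
  have hAv₂ : S₂.Av x = ((S.Av x).erase α).erase β := by rw [hS₂.Av_eq x (.inr rfl), hAv₀]
  -- The palette of b is chosen against that of x only: the edge by has color `f`, king at both
  -- ends, so the overlap with the palette of y is harmless. Hence β need not be high.
  obtain ⟨C, A, hC, hβC', hfC', hAO, hA, hAC, hCA, -⟩ := exists_palette (X := ∅) (B := {f}) (D := D)
    hβC (S.notMem_outSet_self x β) (S.outSet_subset x β) hβo
    (by omega) (by rw [Finset.union_empty, S.card_C, hK]; omega) (by simp [hf]) (by simp; omega)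
  rw [Finset.singleton_subset_iff] at hfC'
  have hβA : β ∉ A := fun h => S.notMem_outSet_self x β (hAO h)
  have hfA : f ∉ A := fun h => hf (S.outSet_subset x β (hAO h))
  have hβf : β ≠ f := fun h => hf (h ▸ hβC)
  obtain ⟨T, hT1, hT2, hT3, hT4, hT5⟩ := exists_tournament_king hβC' hfC' hβf hAC hβA hfA
    (by omega)
  rw [hC] at hT4 hT5
  have hcard : ((C.erase β).erase f).card + 2 = D := by
    rw [Finset.card_erase_of_mem (by simp [hfC', hβf.symm]), Finset.card_erase_of_mem hβC', hC]
    omega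
  have hsub : (C.erase β).erase f ⊆ C := (Finset.erase_subset _ _).trans (Finset.erase_subset _ _)
  obtain ⟨e, hey, hex⟩ : ∃ e : V → K, e y = f ∧ e x = β :=
    ⟨fun v => if v = y then f else β, by simp, by simp [hxy]⟩
  have hcase : ∀ {P : V → Prop}, P y → P x → ∀ v, G.Adj b v → P v := by
    intro P h1 h2 v hv
    rcases hb v hv with rfl | rfl
    exacts [h1, h2]
  obtain ⟨S', h1, h2, h3, h4, h5, h6⟩ := S₂.exists_extend (H' := G) (w := b) hGH e (C := C)
    (T := T) (Av := (C.erase β).erase f) hC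
    (hcase (by rwa [hey]) (by rwa [hex])) (hcase (by simp [hey]) (by simp [hex]))
    (hcase (by rwa [hey]) (by rwa [hex, hC₂])) (hcase (by rwa [hey]) (by simp [hex, hAv₂]))
    (hcase (fun z hz hyz => by rw [hey]; exact hfu z (hGH y z hby.ne' hz hyz))
      (fun z hz hxz => by rw [hex]; exact hS₂.unused z (hGH x z hxb hz hxz)))
    (hcase (fun a ha ha' haf => by
        rw [hey] at haf ⊢
        exact ⟨hfT a ha haf, hT3 a ha' haf⟩)
      (fun a ha ha' haβ => by
        rw [hex] at haβ ⊢
        rw [hC₂] at ha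
        have := hCA a ha' ha haβ
        rw [hT₂]
        exact ⟨(mem_outSet.1 (hAO this)).2, hT2 a this⟩))
    (fun v v' hv hv' h => by
      rcases hb v hv with rfl | rfl <;> rcases hb v' hv' with rfl | rfl
      · rfl
      · rw [hey, hex] at h
        exact absurd h.symm hβf
      · rw [hey, hex] at h
        exact absurd h hβf
      · rfl)
    hT1 hsub (fun a ha => le_trans (by omega) (hT4 a (hsub ha)))
    (hT5 _ (by simp) hsub (by simp) hcard)
  refine ⟨S', fun v hv => ?_, ?_, fun z hz hzx => ?_⟩
  · rw [Walk.support_cons, List.mem_cons, not_or] at hv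
    rw [(h1 v hv.1).2.2, hS₂.Av_eq v (.inl hv.2), hAv₀']
    rintro rfl
    exact hv.2 (Walk.end_mem_support _)
  · rw [(h1 x hxb).2.2, hAv₂, Finset.card_erase_of_mem, Finset.card_erase_of_mem hα]
    · omega
    · simp [hβ, hαβ.symm]
  · by_cases hzb : z = b
    · subst hzb
      rw [h4, hcard]
    · rw [(h1 z hzb).2.2]
      rw [Walk.support_cons, List.mem_cons] at hz
      exact hS₂.card_Av z (hz.resolve_left hzb) hzx

end Scheme
end SimpleGraph

/-! ### Induction over the cactus, and the coloring obtained from a scheme. -/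

namespace SimpleGraph

variable {V K : Type*} {G H : SimpleGraph V} {D : ℕ}

namespace Scheme

theorem exists_of_edgeless [Fintype K] (hK : Fintype.card K = D + D / 2 + 1)
    (hG : ∀ v w, ¬ G.Adj v w) : ∃ S : Scheme G K D, ∀ v, D ≤ (S.Av v).card := by
  classical
  obtain ⟨k⟩ : Nonempty K := Fintype.card_pos_iff.1 (by omega)
  obtain ⟨P, -, hP⟩ := Finset.exists_subset_card_eq (s := (Finset.univ : Finset K)) (n := D)
    (by rw [Finset.card_univ]; omega)
  obtain ⟨T, hT1, -, -, hT2, hT3⟩ := exists_tournament_list P.nodup_toList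
  simp only [Finset.toList_toFinset, Finset.length_toList, hP, Finset.mem_toList] at hT2 hT3
  refine ⟨{
    c := fun _ _ => k
    C := fun _ => P
    T := fun _ => T
    Av := fun _ => P
    c_symm := fun _ _ => rfl
    card_C := fun _ => hP
    mem_C := fun v w h => absurd h (hG v w)
    proper := fun v w _ h => absurd h (hG v w)
    asymm := fun _ => hT1
    dominates := fun v w h => absurd h (hG v w)
    av_subset := fun _ => le_rfl
    av_unused := fun v w h => absurd h (hG v w)
    le_card_outSet := fun _ b hb => le_trans (by omega) (hT2 b hb)
    balanced := fun _ => ?_ }, fun _ => hP.ge⟩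
  have : highSet T P P (D / 2) ⊆ highSet T P P ((D - 1) / 2) := fun a ha => by
    rw [mem_highSet] at ha ⊢
    exact ⟨ha.1, by omega⟩
  have := Finset.card_le_card this
  omega

end Scheme

/-- The graph `G` without the edges that touch `W`. -/
def avoid (G : SimpleGraph V) (W : Set V) : SimpleGraph V where
  Adj y z := G.Adj y z ∧ y ∉ W ∧ z ∉ W
  symm := ⟨fun _ _ h => ⟨h.1.symm, h.2.2, h.2.1⟩⟩
  loopless := ⟨fun _ h => h.1.ne rfl⟩

theorem avoid_adj {W : Set V} {y z : V} : (G.avoid W).Adj y z ↔ G.Adj y z ∧ y ∉ W ∧ z ∉ W :=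
  Iff.rfl

theorem avoid_le (G : SimpleGraph V) (W : Set V) : G.avoid W ≤ G := fun _ _ h => h.1

theorem avoid_lt {W : Set V} {y z : V} (h : G.Adj y z) (hy : y ∈ W) : G.avoid W < G :=
  lt_of_le_not_ge (G.avoid_le W) fun hle => (hle h).2.1 hy

theorem ncard_neighborSet_mono [Finite V] (h : H ≤ G) (v : V) :
    (H.neighborSet v).ncard ≤ (G.neighborSet v).ncard :=
  Set.ncard_le_ncard (fun _ hw => h hw)

/-- A graph with edge-disjoint cycles and degrees at most `D` has a scheme. -/
theorem CyclesEdgeDisjoint.exists_scheme [Finite V] [Fintype K]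
    (hK : Fintype.card K = D + D / 2 + 1) (hG : G.CyclesEdgeDisjoint)
    (hdeg : ∀ v, (G.neighborSet v).ncard ≤ D) :
    ∃ S : Scheme G K D, ∀ v, D ≤ (S.Av v).card + (G.neighborSet v).ncard := by
  classical
  induction G using WellFoundedLT.induction with
  | ind G ih =>
  -- The vertices of `W` stay as isolated vertices; the data they receive here are overwritten
  -- later.
  have hrec : ∀ W : Set V, G.avoid W < G → ∃ S : Scheme (G.avoid W) K D,
      ∀ v, D ≤ (S.Av v).card + ((G.avoid W).neighborSet v).ncard := fun W hW =>
    ih _ hW (hG.mono (G.avoid_le W)) fun v =>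
      (ncard_neighborSet_mono (G.avoid_le W) v).trans (hdeg v)
  by_cases hne : ∃ v w, G.Adj v w
  swap
  · push Not at hne
    obtain ⟨S, hS⟩ := Scheme.exists_of_edgeless hK hne
    exact ⟨S, fun v => (hS v).trans (Nat.le_add_right _ _)⟩
  by_cases hleaf : ∃ w u, G.Adj w u ∧ ∀ y, G.Adj w y → y = u
  · obtain ⟨w, u, hwu, hw⟩ := hleaf
    obtain ⟨S, hS⟩ := hrec {w} (avoid_lt hwu rfl)
    have hlt : ((G.avoid {w}).neighborSet u).ncard < (G.neighborSet u).ncard :=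
      Set.ncard_lt_ncard ⟨fun y hy => hy.1, fun h =>
        (h (show w ∈ G.neighborSet u from hwu.symm)).2.2 rfl⟩
    have h1 : 1 ≤ (G.neighborSet w).ncard := (Set.ncard_pos).2 ⟨u, hwu⟩
    have hu := hS u
    have hdu := hdeg u
    obtain ⟨S', h2, h3, h4⟩ := S.exists_addLeaf hK (H' := G) (u := u) (w := w) (by omega)
      (fun y z hy hz h => ⟨h, hy, hz⟩) hw hwu.ne' (Finset.card_pos.1 (by omega))
      (fun y hy h => ⟨h, hwu.ne', hy⟩)
    refine ⟨S', fun v => ?_⟩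
    by_cases hvu : v = u
    · subst hvu
      omega
    by_cases hvw : v = w
    · subst hvw
      omega
    rw [h2 v hvu hvw]
    exact (hS v).trans (Nat.add_le_add_left (ncard_neighborSet_mono (G.avoid_le _) v) _)
  · push Not at hleaf
    replace hleaf : ∀ v w, G.Adj v w → ∃ w', w' ≠ w ∧ G.Adj v w' := fun v w h => by
      obtain ⟨y, hy, hyw⟩ := hleaf v w h
      exact ⟨y, hyw, hy⟩
    obtain ⟨x, b, d, hbx, hd, hbx', hpend⟩ := hG.exists_pendant_cycle hne hleaf
    -- Reversed, the path ends at the attachment vertex x, from which the cycle is built up.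
    obtain ⟨q, hq⟩ : ∃ q, q = d.reverse := ⟨_, rfl⟩
    have hqp : q.IsPath := hq ▸ hd.reverse
    have hqe : ∀ e, e ∈ d.edges ↔ e ∈ q.edges := fun e => by simp [hq]
    have hqs : ∀ z, z ∈ d.support ↔ z ∈ q.support := fun z => by simp [hq]
    simp only [hqe, hqs] at hbx' hpend
    clear hq hqe hqs hd d
    cases q with
    | nil => exact absurd rfl hbx.ne
    | @cons _ y _ hby q =>
    cases q with
    | nil => simp at hbx'
    | @cons _ y' _ hyy' p =>
    obtain ⟨W, hW⟩ : ∃ W : Set V, ∀ z, z ∈ W ↔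
        z ∈ (Walk.cons hby (.cons hyy' p)).support ∧ z ≠ x := ⟨_, fun z => Iff.rfl⟩
    have hbW : b ∈ W := (hW b).2 ⟨by simp, hbx.ne⟩
    have hbp := ((Walk.cons_isPath_iff _ _).1 hqp).2
    obtain ⟨S, hS⟩ := hrec W (avoid_lt hbx hbW)
    have hedge : ∀ u v, u ≠ b → v ≠ b → G.Adj u v → u ∈ W →
        s(u, v) ∈ (Walk.cons hyy' p).edges := by
      intro u v hu hv huv huW
      have := hpend u ((hW u).1 huW).1 ((hW u).1 huW).2 v huv
      rw [Walk.edges_cons, List.mem_cons, Sym2.eq_iff, Sym2.eq_iff] at this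
      tauto
    -- Removing the cycle costs x its neighbors b and t, so two colors are available at x.
    have hcount : ((G.avoid W).neighborSet x).ncard + 2 ≤ (G.neighborSet x).ncard := by
      obtain ⟨t, ht⟩ : ∃ t, t = (Walk.cons hyy' p).penultimate := ⟨_, rfl⟩
      have htx : G.Adj t x := ht ▸ Walk.adj_penultimate Walk.not_nil_cons
      have hts : t ∈ (Walk.cons hyy' p).support := by
        rw [ht]
        exact Walk.fst_mem_support_of_mem_edges _
          (Walk.mk_penultimate_end_mem_edges Walk.not_nil_cons)
      have htb : t ≠ b := fun h => hbp (h ▸ hts)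
      have htW : t ∈ W := (hW t).2 ⟨by rw [Walk.support_cons]; exact List.mem_cons_of_mem _ hts,
        htx.ne⟩
      have hb' : b ∉ (G.avoid W).neighborSet x := fun h => h.2.2 hbW
      have ht' : t ∉ insert b ((G.avoid W).neighborSet x) := by
        rintro (h | h)
        · exact htb h
        · exact h.2.2 htW
      have hsub : insert t (insert b ((G.avoid W).neighborSet x)) ⊆ G.neighborSet x := by
        rintro v (rfl | rfl | h)
        exacts [htx.symm, hbx.symm, h.1]
      have := Set.ncard_le_ncard hsub
      rwa [Set.ncard_insert_of_notMem ht', Set.ncard_insert_of_notMem hb'] at this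
    have hx := hS x
    have hdx := hdeg x
    obtain ⟨S', h1, h2, h3⟩ := S.exists_addCycle hK (by omega) (x := x) (by omega) hby hyy' p hqp
      (fun z hz hzx v hzv => hzv.2.1 ((hW z).2 ⟨hz, hzx⟩))
      (fun u v hu hv huv => by
        rw [addWalk_adj, avoid_adj]
        by_cases huW : u ∈ W
        · exact .inr (hedge u v hu hv huv huW)
        by_cases hvW : v ∈ W
        · rw [Sym2.eq_swap]
          exact .inr (hedge v u hv hu huv.symm hvW)
        · exact .inl ⟨huv, huW, hvW⟩)
      (fun v hv => by
        have := hpend b (by simp) hbx.ne v hv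
        rw [Walk.edges_cons, List.mem_cons, Sym2.eq_iff, Sym2.eq_iff] at this
        have h1 := hby.ne
        have h2 := hbx.ne
        have h3 : s(b, v) ∉ (Walk.cons hyy' p).edges := fun h =>
          hbp (Walk.fst_mem_support_of_mem_edges _ h)
        tauto)
    refine ⟨S', fun v => ?_⟩
    by_cases hvx : v = x
    · subst hvx
      omega
    by_cases hv : v ∈ (Walk.cons hby (.cons hyy' p)).support
    · refine (h3 v hv hvx).trans (Nat.add_le_add_left ?_ _)
      obtain ⟨z, hvz⟩ : ∃ z, G.Adj v z := by
        rw [Walk.mem_support_iff_exists_mem_edges] at hv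
        obtain ⟨e, he, hve⟩ := hv.resolve_left hvx
        obtain ⟨z, rfl⟩ := Sym2.mem_iff_exists.1 hve
        exact ⟨z, Walk.adj_of_mem_edges _ he⟩
      obtain ⟨z', hz', hvz'⟩ := hleaf v z hvz
      exact (Set.one_lt_ncard_iff).2 ⟨z, z', hvz, hvz', hz'.symm⟩
    · rw [h1 v hv]
      exact (hS v).trans (Nat.add_le_add_left (ncard_neighborSet_mono (G.avoid_le _) v) _)

/-- The coloring of a scheme is proper and has no bicolored path or cycle with four edges. -/
theorem Scheme.exists_isStarEdgeColoring (S : Scheme G K D) :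
    ∃ c : G.lineGraph.Coloring K, IsStarEdgeColoring c := by
  obtain ⟨f, hf⟩ : ∃ f : Sym2 V → K, ∀ v w, f s(v, w) = S.c v w :=
    ⟨Sym2.lift ⟨S.c, S.c_symm⟩, fun v w => rfl⟩
  have hproper : ∀ e e' : G.edgeSet, G.lineGraph.Adj e e' → f e ≠ f e' := by
    rintro ⟨e, he⟩ ⟨e', he'⟩ ⟨hne, v, hv, hv'⟩
    obtain ⟨y, rfl⟩ := Sym2.mem_iff_exists.1 hv
    obtain ⟨z, rfl⟩ := Sym2.mem_iff_exists.1 hv'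
    intro h
    rw [hf, hf] at h
    exact hne (Subtype.ext (congrArg (fun t => s(v, t)) (S.proper v y z he he' h)))
  refine ⟨Coloring.mk (fun e => f e) fun {e e'} h => hproper e e' h, ?_⟩
  -- The case x₀ = x₄ is allowed, so this covers paths and 4-cycles alike.
  have key : ∀ {x₀ x₁ x₂ x₃ x₄ : V} (h₁ : G.Adj x₀ x₁) (h₂ : G.Adj x₁ x₂) (h₃ : G.Adj x₂ x₃)
      (h₄ : G.Adj x₃ x₄), x₀ ≠ x₂ → x₁ ≠ x₃ → x₂ ≠ x₄ →
      ¬ IsBicolored (G := G) (fun e => f e) (.cons h₁ (.cons h₂ (.cons h₃ (.cons h₄ .nil)))) := by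
    rintro x₀ x₁ x₂ x₃ x₄ h₁ h₂ h₃ h₄ h02 h13 h24 ⟨a, b, hab⟩
    have e₁ := hab ⟨s(x₀, x₁), h₁⟩ (by simp)
    have e₂ := hab ⟨s(x₁, x₂), h₂⟩ (by simp)
    have e₃ := hab ⟨s(x₂, x₃), h₃⟩ (by simp)
    have e₄ := hab ⟨s(x₃, x₄), h₄⟩ (by simp)
    simp only [hf] at e₁ e₂ e₃ e₄
    have n₁ : S.c x₀ x₁ ≠ S.c x₁ x₂ := fun h => h02
      (S.proper x₁ x₀ x₂ h₁.symm h₂ (by rw [S.c_symm, h]))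
    have n₂ : S.c x₁ x₂ ≠ S.c x₂ x₃ := fun h => h13
      (S.proper x₂ x₁ x₃ h₂.symm h₃ (by rw [S.c_symm, h]))
    have n₃ : S.c x₂ x₃ ≠ S.c x₃ x₄ := fun h => h24
      (S.proper x₃ x₂ x₄ h₃.symm h₄ (by rw [S.c_symm, h]))
    have e13 : S.c x₀ x₁ = S.c x₂ x₃ := by
      rcases e₁ with e₁ | e₁ <;> rcases e₂ with e₂ | e₂ <;> rcases e₃ with e₃ | e₃ <;>
        simp_all
    have e24 : S.c x₃ x₄ = S.c x₁ x₂ := by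
      rcases e₄ with e₄ | e₄ <;> rcases e₂ with e₂ | e₂ <;> rcases e₃ with e₃ | e₃ <;>
        simp_all
    -- At the middle vertex each of the two colors would dominate the other.
    have d₁ := S.dominates x₂ x₁ h₂.symm (S.c x₂ x₃) (S.mem_C _ _ h₃)
      (by rw [← e13, S.c_symm]; exact S.mem_C _ _ h₁.symm) (by rw [S.c_symm x₂ x₁]; exact n₂.symm)
    have d₂ := S.dominates x₂ x₃ h₃ (S.c x₂ x₁) (S.mem_C _ _ h₂.symm)
      (by rw [S.c_symm, ← e24]; exact S.mem_C _ _ h₄) (by rw [S.c_symm x₂ x₁]; exact n₂)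
    exact S.asymm _ _ _ d₁ d₂
  constructor
  · intro u v p hp hlen
    rcases p with _ | ⟨h₁, _ | ⟨h₂, _ | ⟨h₃, _ | ⟨h₄, _ | ⟨h₅, p⟩⟩⟩⟩⟩ <;>
      simp only [Walk.length_nil, Walk.length_cons] at hlen <;> try omega
    have := hp.support_nodup
    simp only [Walk.support_cons, Walk.support_nil, List.nodup_cons, List.mem_cons, not_or] at this
    exact key h₁ h₂ h₃ h₄ (by tauto) (by tauto) (by tauto)
  · intro u p hp hlen
    rcases p with _ | ⟨h₁, _ | ⟨h₂, _ | ⟨h₃, _ | ⟨h₄, _ | ⟨h₅, p⟩⟩⟩⟩⟩ <;>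
      simp only [Walk.length_nil, Walk.length_cons] at hlen <;> try omega
    have := hp.support_nodup
    simp only [Walk.support_cons, Walk.support_nil, List.tail_cons, List.nodup_cons, List.mem_cons,
      not_or] at this
    exact key h₁ h₂ h₃ h₄ (by tauto) (by tauto) (by tauto)

end SimpleGraph

theorem mainTheorem1 {V : Type*} [Fintype V] (G : SimpleGraph V) [DecidableRel G.Adj]
    (hG : G.IsCactus) :
    G.starChromaticIndex ≤ ((3 * G.maxDegree / 2 + 1 : ℕ) : ℕ∞) := by
  have hK : Fintype.card (Fin (3 * G.maxDegree / 2 + 1)) = G.maxDegree + G.maxDegree / 2 + 1 := by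
    rw [Fintype.card_fin]
    omega
  obtain ⟨S, -⟩ := hG.cyclesEdgeDisjoint.exists_scheme hK fun v => by
    rw [← Nat.card_coe_set_eq, Nat.card_eq_fintype_card, SimpleGraph.card_neighborSet_eq_degree]
    exact G.degree_le_maxDegree v
  exact iInf_le (fun k : {k : ℕ // G.StarEdgeColorable k} => ((k : ℕ) : ℕ∞))
    ⟨_, S.exists_isStarEdgeColoring⟩
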